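/- Let $K=\mathbb{F}_q$ be a finite field, let $n\ge 1$, let $v_1,\ldots,v_n$ be positive integers, and let $$X=\{[(x_1^{v_1},\ldots,x_n^{v_n})]\;:\; x_i\in K^*\text{ for all }i\}\subset\mathbb{P}^{n-1}$$ be the degenerate projective torus over $K$ that they parameterize. Let $S=K[t_1,\ldots,t_n]=\bigoplus_{d\ge 0}S_d$ have the standard grading, and let $I(X)\subset S$ be the vanishing ideal of $X$, that is, the ideal generated by the homogeneous polynomials that vanish on $X$. Let $\beta$ be a generator of the cyclic group $K^*$, write $o(\cdot)$ for the order of an element of $K^*$, and put $d_i=o(\beta^{v_i})$ for $i=1,\ldots,n$, $r=\gcd(d_1,\ldots,d_n)$ and $d_i'=o(\beta^{rv_i})$. Let $\mathcal{S}'=\mathbb{N}d_1'+\cdots+\mathbb{N}d_n'\subset\mathbb{N}$ be the semigroup generated by $d_1',\ldots,d_n'$, where $0\in\mathbb{N}$, and let $g(\mathcal{S}')\in\mathbb{Z}$ be its Frobenius number, the largest integer not in $\mathcal{S}'$ (so $g(\mathcal{S}')=-1$ if $\mathcal{S}'=\mathbb{N}$). Let $H_X(d)=\dim_K\big(S_d/(I(X)\cap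 S_d)\big)$ be the Hilbert function of $S/I(X)$, let $k$ be the Krull dimension of $S/I(X)$, and let $h_X(t)=\sum_{i=0}^{k-1}c_it^i\in\mathbb{Q}[t]$ be the Hilbert polynomial, the unique polynomial of degree $k-1$ with $h_X(d)=H_X(d)$ for all large $d$. The degree of $S/I(X)$ is $\deg(S/I(X))=c_{k-1}(k-1)!$, and its index of regularity $\operatorname{reg}(S/I(X))$ is the least integer $\ell\ge 0$ such that $h_X(d)=H_X(d)$ for all $d\ge\ell$. The ideal $I(X)$ is called a complete intersection if it can be generated by $m$ elements, where $m$ is the height of $I(X)$. Then the following hold. (i) $\displaystyle \deg(S/I(X))=\frac{d_1\cdots d_n}{\gcd(d_1,\ldots,d_n)}$. (ii) If $I(X)$ is a complete intersection, then $$\operatorname{reg}(S/I(X))=\gcd(d_1,\ldots,d_n)\,g(\mathcal{S}')+\sum_{i=1}^n d_i-(n-1).$$ -/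

import Mathlib

open scoped LinearAlgebra.Projectivization

namespace DegenerateTorus

/-- The degenerate projective torus
`X = {[(x_1^{v_1}, …, x_n^{v_n})] | x_i ∈ K^* for all i} ⊆ ℙ^{n-1}`
parameterized by the monomials `x_1^{v_1}, …, x_n^{v_n}`. -/
def torus (K : Type*) [Field K] {n : ℕ} (v : Fin n → ℕ) : Set (ℙ K (Fin n → K)) :=
  {p | ∃ (x : Fin n → Kˣ) (h : (fun i => (x i : K) ^ v i) ≠ 0),
    p = Projectivization.mk K (fun i => (x i : K) ^ v i) h}

/-- The vanishing ideal `I(Y)` of a set `Y` of points of projective space: the ideal of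
`S = K[t_1, …, t_n]` generated by the homogeneous polynomials that vanish at all points of `Y`
(that is, at every vector of homogeneous coordinates of every point of `Y`). -/
noncomputable def vanishingIdeal {K : Type*} [Field K] {n : ℕ} (Y : Set (ℙ K (Fin n → K))) :
    Ideal (MvPolynomial (Fin n) K) :=
  Ideal.span {f | (∃ e : ℕ, f.IsHomogeneous e) ∧
    ∀ (w : Fin n → K) (hw : w ≠ 0), Projectivization.mk K w hw ∈ Y → MvPolynomial.eval w f = 0}

/-- The Hilbert function `e ↦ dim_K (S_e / (I ∩ S_e))` of `S / I`, where `S = K[t_1, …, t_n]`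
has the standard grading. -/
noncomputable def hilbertFunction {K : Type*} [Field K] {n : ℕ}
    (I : Ideal (MvPolynomial (Fin n) K)) (e : ℕ) : ℕ :=
  Module.finrank K (MvPolynomial.homogeneousSubmodule (Fin n) K e ⧸
    (I.restrictScalars K).comap (MvPolynomial.homogeneousSubmodule (Fin n) K e).subtype)

/-- `h` is the Hilbert polynomial of `S / I`, a ring of positive Krull dimension `k`: a polynomial
of degree `k - 1` with rational coefficients that agrees with the Hilbert function
at all large degrees. (At most one polynomial has the latter property.) -/
structure IsHilbertPolynomial {K : Type*} [Field K] {n : ℕ}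
    (I : Ideal (MvPolynomial (Fin n) K)) (h : Polynomial ℚ) : Prop where
  eventually_eq : ∀ᶠ e : ℕ in Filter.atTop, h.eval (e : ℚ) = (hilbertFunction I e : ℚ)
  natDegree_add_one :
    (h.natDegree : WithBot ℕ∞) + 1 = ringKrullDim (MvPolynomial (Fin n) K ⧸ I)

/-- `S / I` has degree `δ`: if `c_{k-1} t^{k-1} + … + c_0` is the Hilbert polynomial of `S / I`,
of degree `k - 1`, then `δ = c_{k-1} (k-1)!`. -/
def HasDegree {K : Type*} [Field K] {n : ℕ}
    (I : Ideal (MvPolynomial (Fin n) K)) (δ : ℚ) : Prop :=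
  ∃ h : Polynomial ℚ, IsHilbertPolynomial I h ∧
    δ = h.coeff h.natDegree * (h.natDegree.factorial : ℚ)

/-- `S / I` has index of regularity `ℓ`: it is the least integer `ℓ ≥ 0` such that the Hilbert
polynomial and the Hilbert function agree at all degrees `e ≥ ℓ`. -/
def HasRegularityIndex {K : Type*} [Field K] {n : ℕ}
    (I : Ideal (MvPolynomial (Fin n) K)) (ℓ : ℕ) : Prop :=
  ∃ h : Polynomial ℚ, IsHilbertPolynomial I h ∧
    IsLeast {l : ℕ | ∀ e : ℕ, l ≤ e → h.eval (e : ℚ) = (hilbertFunction I e : ℚ)} ℓ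

/-- An ideal is a complete intersection if it can be generated by `m` elements, where `m` is
its height. -/
def IsCompleteIntersection {R : Type*} [CommRing R] (I : Ideal R) : Prop :=
  ∃ (m : ℕ) (g : Fin m → R), I.height = (m : ℕ∞) ∧ I = Ideal.span (Set.range g)

/-- `g` is the Frobenius number of the subsemigroup `T` of `ℕ`: the largest integer not in `T`.
It is an element of `ℤ`, since the Frobenius number of `ℕ` is `-1`. -/
def IsFrobeniusNumber (T : AddSubmonoid ℕ) (g : ℤ) : Prop :=
  IsGreatest {z : ℤ | ¬ ∃ s ∈ T, (s : ℤ) = z} g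

end DegenerateTorus

/-!
A form of degree `e` vanishes on the torus `X` exactly when it vanishes at all the affine
representatives `(x_1^{v_1}, …, x_n^{v_n})`. These are the values of a homomorphism on the group
`(K^*)^n`, so a monomial `t^a` restricts to a character of `(K^*)^n`. By Dedekind's theorem distinct
characters are linearly independent, hence `H_X(e)` is the number of characters `t^a` with
`|a| = e` (`hilbertFunction_eq_ncard_character`). Evaluating at the points with a generator of `K^*`
in one place and `1` elsewhere shows that `t^a` and `t^b` give the same character exactly when
`a_i ≡ b_i mod d_i` for all `i`, so `H_X(e)` counts the classes `b ∈ ∏ ℤ/d_i`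
that are represented by some `a ∈ ℕ^n` with `|a| = e`
(`hilbertFunction_eq_ncard_residue`).

Let `|b|` be the degree of the representative of `b` with entries in `[0, d_i)`. Other representatives
in `ℕ^n` arise by adding multiples of the `d_i = r d_i'`, so `b` is counted in degree `e` exactly when
`e - |b| ∈ r 𝒮'`, where `𝒮'` is the semigroup generated by the `d_i'` (`mem_residue_image_iff`). Such a
`b` has `|b| ≡ e mod r`, which leaves `d_1 ⋯ d_n / r` classes (`ncard_boxDegree_cast_eq_mul`), and all of
them are counted when `e > r g + ∑ (d_i - 1)` for the Frobenius number `g` of `𝒮'`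
(`ncard_residue_image_eq`), since `|b| ≤ ∑ (d_i - 1)`. In degree `r g + ∑ (d_i - 1)` the class of
`(d_1 - 1, …, d_n - 1)` is missing (`ncard_residue_image_ne`). As `S / I(X)` has Krull dimension one
(`ringKrullDim_quotient_vanishingIdeal_torus`), the Hilbert polynomial is the constant
`d_1 ⋯ d_n / r`, which is the degree, and the index of regularity is `r g + ∑ (d_i - 1) + 1`.
-/

namespace DegenerateTorus

open MvPolynomial

/-! ### Homogeneous polynomials vanishing on the torus -/

theorem aeval_smul_of_isHomogeneous {R A σ : Type*} [CommSemiring R] [CommSemiring A] [Algebra R A]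
    [Fintype σ] {f : MvPolynomial σ R} {e : ℕ} (hf : f.IsHomogeneous e) (c : A) (w : σ → A) :
    aeval (c • w) f = c ^ e * aeval w f := by
  rw [aeval_def, aeval_def, eval₂_eq', eval₂_eq', Finset.mul_sum]
  refine Finset.sum_congr rfl fun a ha => ?_
  have hdeg : ∑ i, a i = e := by
    rw [← Finsupp.degree_eq_sum, Finsupp.degree_eq_weight_one]
    exact hf (mem_support_iff.1 ha)
  simp only [Pi.smul_apply, smul_eq_mul, mul_pow, Finset.prod_mul_distrib]
  rw [Finset.prod_pow_eq_pow_sum, hdeg]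
  ring

variable {K : Type*} [Field K] {n : ℕ}

theorem eval_eq_zero_of_mem_vanishingIdeal {Y : Set (ℙ K (Fin n → K))} {w : Fin n → K}
    (hw : w ≠ 0) (hY : Projectivization.mk K w hw ∈ Y) {f : MvPolynomial (Fin n) K}
    (hf : f ∈ vanishingIdeal Y) : eval w f = 0 := by
  have h : vanishingIdeal Y ≤ RingHom.ker (eval w) :=
    Ideal.span_le.2 fun g hg => (RingHom.mem_ker).2 (hg.2 w hw hY)
  exact (RingHom.mem_ker).1 (h hf)

/-- The affine representative `(x_1^{v_1}, …, x_n^{v_n})` of a point of the torus. -/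
def torusPoint (v : Fin n → ℕ) (x : Fin n → Kˣ) : Fin n → K := fun i => (x i : K) ^ v i

theorem torusPoint_ne_zero (i₀ : Fin n) (v : Fin n → ℕ) (x : Fin n → Kˣ) : torusPoint v x ≠ 0 :=
  fun h => pow_ne_zero (v i₀) (x i₀).ne_zero (congrFun h i₀)

/-- For forms, vanishing at one affine representative of each point of the torus suffices. The index
`i₀` serves only to exclude `n = 0`. -/
theorem mem_vanishingIdeal_torus_iff (i₀ : Fin n) (v : Fin n → ℕ) {f : MvPolynomial (Fin n) K}
    {e : ℕ} (hf : f.IsHomogeneous e) :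
    f ∈ vanishingIdeal (torus K v) ↔ ∀ x, eval (torusPoint v x) f = 0 := by
  constructor
  · intro h x
    have hx := torusPoint_ne_zero i₀ v x
    exact eval_eq_zero_of_mem_vanishingIdeal hx (show _ ∈ torus K v from ⟨x, hx, rfl⟩) h
  · intro h
    refine Ideal.subset_span ⟨⟨e, hf⟩, fun w hw ⟨x, hx, hwx⟩ => ?_⟩
    obtain ⟨c, rfl⟩ := (Projectivization.mk_eq_mk_iff' K _ _ hw hx).1 hwx
    have := aeval_smul_of_isHomogeneous hf c (torusPoint v x)
    simp only [aeval_eq_eval] at this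
    exact this.trans (by rw [h x, mul_zero])

/-! ### The Hilbert function counts characters -/

/-- The monomial `t^a`, evaluated at the representatives `(x_1^{v_1}, …, x_n^{v_n})` of the points
of the torus, as a character of the group `(K^*)^n`. -/
def character (v : Fin n → ℕ) (a : Fin n →₀ ℕ) : (Fin n → Kˣ) →* K where
  toFun x := ∏ i, torusPoint v x i ^ a i
  map_one' := by simp [torusPoint]
  map_mul' x y := by simp [torusPoint, mul_pow, Finset.prod_mul_distrib]

theorem character_apply (v : Fin n → ℕ) (a : Fin n →₀ ℕ) (x : Fin n → Kˣ) :
    character v a x = ∏ i, torusPoint v x i ^ a i := rfl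

/-- Evaluation of the forms of degree `e` at the affine representatives of the points
of the torus. -/
noncomputable def evalTorus (v : Fin n → ℕ) (e : ℕ) :
    homogeneousSubmodule (Fin n) K e →ₗ[K] ((Fin n → Kˣ) → K) :=
  (LinearMap.pi fun x => (aeval (torusPoint v x)).toLinearMap) ∘ₗ Submodule.subtype _

theorem range_evalTorus (v : Fin n → ℕ) (e : ℕ) :
    LinearMap.range (evalTorus (K := K) v e) = Submodule.span K
      ((fun χ : (Fin n → Kˣ) →* K => (χ : (Fin n → Kˣ) → K)) ''
        (character v '' {a | a.degree = e})) := by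
  rw [evalTorus, LinearMap.range_comp, Submodule.range_subtype,
    homogeneousSubmodule_eq_finsupp_supported, AddMonoidAlgebra.supported_eq_span_single,
    Submodule.map_span, Set.image_image, Set.image_image]
  congr 1
  refine Set.image_congr fun a _ => ?_
  funext x
  change aeval (torusPoint v x) (monomial a (1 : K)) = character v a x
  rw [aeval_monomial, map_one, one_mul, Finsupp.prod_fintype _ _ (by simp), character_apply]

/-- The forms of degree `e` modulo those that vanish on the torus have the characters `t^a` with
`|a| = e` as a spanning set, and distinct characters are linearly independent (Dedekind). -/
theorem hilbertFunction_eq_ncard_character (i₀ : Fin n) (v : Fin n → ℕ) (e : ℕ) :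
    hilbertFunction (vanishingIdeal (torus K v)) e =
      (character (K := K) v '' {a | a.degree = e}).ncard := by
  have hker : ((vanishingIdeal (torus K v)).restrictScalars K).comap
      (homogeneousSubmodule (Fin n) K e).subtype = LinearMap.ker (evalTorus v e) := by
    ext f
    have := mem_vanishingIdeal_torus_iff i₀ v f.2
    simpa [evalTorus, funext_iff, aeval_eq_eval] using this
  have hfin : {a : Fin n →₀ ℕ | a.degree = e}.Finite := by
    exact (Finsupp.finite_of_degree_le e).subset fun a ha => le_of_eq ha
  have hfin' := hfin.image (character (K := K) v)
  have := hfin'.fintype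
  have hli := (linearIndependent_monoidHom (Fin n → Kˣ) K).comp
    (Subtype.val : (character (K := K) v '' {a | a.degree = e}) → _) Subtype.val_injective
  rw [hilbertFunction, hker, (LinearMap.quotKerEquivRange _).finrank_eq, range_evalTorus,
    Set.image_eq_range, ← Nat.card_coe_set_eq, Nat.card_eq_fintype_card]
  exact finrank_span_eq_card hli

theorem character_eq_iff {β : Kˣ} (hβ : ∀ x : Kˣ, x ∈ Subgroup.zpowers β) (v : Fin n → ℕ)
    (a b : Fin n →₀ ℕ) :
    character (K := K) v a = character v b ↔ ∀ i, a i ≡ b i [MOD orderOf (β ^ v i)] := by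
  constructor
  · intro h i
    -- compare the characters at the point with `β` in place `i` and `1` elsewhere
    have hp : ∀ c : Fin n →₀ ℕ, character (K := K) v c (Pi.mulSingle i β) =
        (((β ^ v i) ^ c i : Kˣ) : K) := by
      intro c
      rw [character_apply, Finset.prod_eq_single i]
      · simp [torusPoint]
      · intro j _ hj
        simp [torusPoint, Pi.mulSingle_eq_of_ne hj]
      · simp
    rw [← pow_eq_pow_iff_modEq]
    apply Units.ext
    rw [← hp, ← hp, h]
  · intro h
    refine MonoidHom.ext fun x => ?_
    rw [character_apply, character_apply]
    refine Finset.prod_congr rfl fun i _ => ?_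
    obtain ⟨k, hk⟩ := Subgroup.mem_zpowers_iff.1 (hβ (x i))
    have : (x i ^ v i) ^ a i = (x i ^ v i) ^ b i := by
      have hx : x i ^ v i = (β ^ v i) ^ k := by
        rw [← hk, ← zpow_natCast, ← zpow_natCast, zpow_comm]
      have hc (c : ℕ) : ((β ^ v i) ^ k) ^ c = ((β ^ v i) ^ c) ^ k := by
        rw [← zpow_natCast, ← zpow_natCast (β ^ v i), zpow_comm]
      rw [hx, hc, hc, pow_eq_pow_iff_modEq.2 (h i)]
    simpa [torusPoint] using congrArg (Units.val : Kˣ → K) this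

/-- The exponent vector `a`, reduced modulo `d_i` in place `i`. -/
def residue (d : Fin n → ℕ) (a : Fin n →₀ ℕ) : ∀ i, ZMod (d i) := fun i => (a i : ZMod (d i))

theorem ncard_image_eq_of_eq_iff {α β γ : Type*} {f : α → β} {g : α → γ}
    (h : ∀ a b, f a = f b ↔ g a = g b) (s : Set α) : (f '' s).ncard = (g '' s).ncard := by
  refine Set.ncard_congr (fun y hy => g hy.choose) ?_ ?_ ?_
  · intro y hy
    exact ⟨_, hy.choose_spec.1, rfl⟩
  · intro y z hy hz hyz
    rw [← hy.choose_spec.2, ← hz.choose_spec.2]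
    exact (h _ _).2 hyz
  · rintro _ ⟨a, ha, rfl⟩
    have hy : f a ∈ f '' s := ⟨a, ha, rfl⟩
    exact ⟨f a, hy, (h _ _).1 hy.choose_spec.2⟩

theorem hilbertFunction_eq_ncard_residue (i₀ : Fin n) {β : Kˣ}
    (hβ : ∀ x : Kˣ, x ∈ Subgroup.zpowers β) (v : Fin n → ℕ) (d : Fin n → ℕ)
    (hd : ∀ i, d i = orderOf (β ^ v i)) (e : ℕ) :
    hilbertFunction (vanishingIdeal (torus K v)) e = (residue d '' {a | a.degree = e}).ncard := by
  rw [hilbertFunction_eq_ncard_character i₀]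
  refine ncard_image_eq_of_eq_iff (fun a b => ?_) _
  rw [character_eq_iff hβ, funext_iff]
  refine forall_congr' fun i => ?_
  rw [residue, residue, ZMod.natCast_eq_natCast_iff, hd]

/-! ### Residues of exponent vectors of given degree -/

/-- The degree of the exponent vector with entries in `[0, d_i)` that represents `b`. -/
def boxDegree {d : Fin n → ℕ} (b : ∀ i, ZMod (d i)) : ℕ := ∑ i, (b i).val

variable {d d' : Fin n → ℕ} {r : ℕ}

/-- The representatives of `b` in `ℕ^n` are the one with entries in `[0, d_i)` plus the vectors
`(d_1 c_1, …, d_n c_n)`, and `∑ d_i c_i = r ∑ d_i' c_i`. -/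
theorem mem_residue_image_iff [∀ i, NeZero (d i)] (h : ∀ i, d i = r * d' i) (e : ℕ)
    (b : ∀ i, ZMod (d i)) :
    b ∈ residue d '' {a | a.degree = e} ↔
      ∃ s ∈ AddSubmonoid.closure (Set.range d'), boxDegree b + r * s = e := by
  simp only [AddSubmonoid.mem_closure_range_iff_of_fintype]
  constructor
  · rintro ⟨a, ha, rfl⟩
    refine ⟨∑ i, (a i / d i) • d' i, ⟨fun i => a i / d i, rfl⟩, ?_⟩
    rw [Set.mem_ofPred_eq, Finsupp.degree_eq_sum] at ha
    rw [← ha, boxDegree, Finset.mul_sum, ← Finset.sum_add_distrib]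
    refine Finset.sum_congr rfl fun i _ => ?_
    rw [residue, ZMod.val_natCast, smul_eq_mul]
    conv_rhs => rw [← Nat.mod_add_div (a i) (d i)]
    rw [mul_left_comm, ← h, mul_comm (d i)]
  · rintro ⟨s, ⟨c, rfl⟩, hs⟩
    refine ⟨Finsupp.equivFunOnFinite.symm fun i => (b i).val + d i * c i, ?_, ?_⟩
    · rw [Set.mem_ofPred_eq, Finsupp.degree_eq_sum, ← hs, boxDegree, Finset.mul_sum,
        ← Finset.sum_add_distrib]
      refine Finset.sum_congr rfl fun i _ => ?_
      simp only [Finsupp.equivFunOnFinite_symm_apply_apply, smul_eq_mul]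
      rw [mul_left_comm, ← h, mul_comm (d i)]
    · funext i
      simp [residue]

/-- The sum of the coordinates is a surjective homomorphism `∏ ℤ/d_i → ℤ/r`, so all its fibres have
the same number of elements. -/
theorem ncard_boxDegree_cast_eq_mul [∀ i, NeZero (d i)] [NeZero r] (hr : ∀ i, r ∣ d i)
    (i₀ : Fin n) (c : ZMod r) :
    {b : ∀ i, ZMod (d i) | (boxDegree b : ZMod r) = c}.ncard * r = ∏ i, d i := by
  classical
  let φ : (∀ i, ZMod (d i)) →+ ZMod r :=
    ∑ i, (ZMod.castHom (hr i) (ZMod r)).toAddMonoidHom.comp (Pi.evalAddMonoidHom _ i)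
  have hφ : ∀ b, φ b = (boxDegree b : ZMod r) := by
    intro b
    simp [φ, boxDegree]
  have hsurj : ∀ y : ZMod r, y ∈ Set.range φ := by
    intro y
    obtain ⟨z, hz⟩ := ZMod.castHom_surjective (hr i₀) y
    refine ⟨Pi.single i₀ z, ?_⟩
    simp only [φ, AddMonoidHom.finsetSum_apply]
    rw [Finset.sum_eq_single i₀]
    · simpa using hz
    · intro j _ hj
      simp [Pi.single_eq_of_ne hj]
    · simp
  have hcard : ∀ y, (Finset.univ.filter fun b => φ b = y).card =
      {b : ∀ i, ZMod (d i) | (boxDegree b : ZMod r) = c}.ncard := by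
    intro y
    rw [AddMonoidHom.card_fiber_eq_of_mem_range φ (hsurj y) (hsurj c), ← Set.ncard_coe_finset]
    congr 1
    ext b
    simp [hφ]
  have := Finset.card_eq_sum_card_fiberwise (f := φ) (s := Finset.univ) (t := Finset.univ)
    (by simp)
  simp only [hcard, Finset.sum_const, Finset.card_univ, Fintype.card_pi, ZMod.card,
    smul_eq_mul] at this
  rw [this, mul_comm]

theorem residue_image_subset [∀ i, NeZero (d i)] (h : ∀ i, d i = r * d' i) (e : ℕ) :
    residue d '' {a | a.degree = e} ⊆
      {b : ∀ i, ZMod (d i) | (boxDegree b : ZMod r) = (e : ZMod r)} := by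
  intro b hb
  obtain ⟨s, -, hs⟩ := (mem_residue_image_iff h e b).1 hb
  rw [Set.mem_ofPred_eq, ← hs]
  simp

/-- The Hilbert function attains the value `d_1 ⋯ d_n / r` in degree `e` exactly when every class whose
degree is congruent to `e` modulo `r` is represented in degree `e`. -/
theorem ncard_residue_image_eq_iff [∀ i, NeZero (d i)] [NeZero r] (h : ∀ i, d i = r * d' i)
    (i₀ : Fin n) (e : ℕ) :
    (residue d '' {a | a.degree = e}).ncard * r = ∏ i, d i ↔
      ∀ b : ∀ i, ZMod (d i), (boxDegree b : ZMod r) = (e : ZMod r) →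
        ∃ s ∈ AddSubmonoid.closure (Set.range d'), boxDegree b + r * s = e := by
  have hr : ∀ i, r ∣ d i := fun i => ⟨_, h i⟩
  rw [← ncard_boxDegree_cast_eq_mul hr i₀ (e : ZMod r), Nat.mul_left_inj (NeZero.ne r)]
  constructor
  · intro hc b hb
    have := Set.eq_of_subset_of_ncard_le (residue_image_subset h e) hc.ge
    rw [← mem_residue_image_iff h, this]
    exact hb
  · intro hb
    congr 1
    refine (residue_image_subset h e).antisymm fun b hbe => ?_
    exact (mem_residue_image_iff h e b).2 (hb b hbe)

theorem ncard_residue_image_eq [∀ i, NeZero (d i)] [NeZero r] (h : ∀ i, d i = r * d' i)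
    (i₀ : Fin n) {g : ℤ} (hg : IsFrobeniusNumber (AddSubmonoid.closure (Set.range d')) g) {e : ℕ}
    (he : (r : ℤ) * g + ∑ i, ((d i : ℤ) - 1) < e) :
    (residue d '' {a | a.degree = e}).ncard * r = ∏ i, d i := by
  rw [ncard_residue_image_eq_iff h i₀]
  intro b hb
  have hbox : (boxDegree b : ℤ) ≤ ∑ i, ((d i : ℤ) - 1) := by
    rw [boxDegree, Nat.cast_sum]
    refine Finset.sum_le_sum fun i _ => ?_
    have := ZMod.val_lt (b i)
    lia
  obtain ⟨z, hz⟩ : (r : ℤ) ∣ (e : ℤ) - boxDegree b := by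
    rw [← ZMod.intCast_zmod_eq_zero_iff_dvd]
    push_cast
    rw [hb, sub_self]
  have hrpos : (0 : ℤ) < r := by exact_mod_cast NeZero.pos r
  have hgz : g < z := by
    have : (r : ℤ) * g < r * z := by lia
    exact lt_of_mul_lt_mul_left this hrpos.le
  have hmem : ∃ s ∈ AddSubmonoid.closure (Set.range d'), (s : ℤ) = z := by
    by_contra hcon
    exact absurd (hg.2 hcon) (not_le.2 hgz)
  obtain ⟨s, hs, rfl⟩ := hmem
  refine ⟨s, hs, ?_⟩
  zify
  lia

/-- In degree `r g + ∑ (d_i - 1)` the residue of `(d_1 - 1, …, d_n - 1)` is not attained. -/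
theorem ncard_residue_image_ne [∀ i, NeZero (d i)] [NeZero r] (h : ∀ i, d i = r * d' i)
    (i₀ : Fin n) {g : ℤ} (hg : IsFrobeniusNumber (AddSubmonoid.closure (Set.range d')) g) {e : ℕ}
    (he : (r : ℤ) * g + ∑ i, ((d i : ℤ) - 1) = e) :
    (residue d '' {a | a.degree = e}).ncard * r ≠ ∏ i, d i := by
  rw [ne_eq, ncard_residue_image_eq_iff h i₀]
  intro hb
  let b : ∀ i, ZMod (d i) := fun i => ((d i - 1 : ℕ) : ZMod (d i))
  have hbox : (boxDegree b : ℤ) = ∑ i, ((d i : ℤ) - 1) := by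
    rw [boxDegree, Nat.cast_sum]
    refine Finset.sum_congr rfl fun i _ => ?_
    have := NeZero.pos (d i)
    rw [ZMod.val_natCast, Nat.mod_eq_of_lt (by lia)]
    lia
  rw [← hbox] at he
  obtain ⟨s, hs, hse⟩ := hb b (by
    have := congrArg (Int.cast : ℤ → ZMod r) he
    push_cast at this
    simpa using this)
  refine hg.1 ⟨s, hs, ?_⟩
  have hr0 : (r : ℤ) ≠ 0 := by exact_mod_cast NeZero.ne r
  apply mul_left_cancel₀ hr0
  zify at hse
  lia

/-- Coprime generators give a Frobenius number. It is at least `-1` since a semigroup of natural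
numbers does not contain `-1`. -/
theorem exists_isFrobeniusNumber {s : Set ℕ} (hs : Nat.setGcd s = 1) :
    ∃ g : ℤ, IsFrobeniusNumber (AddSubmonoid.closure s) g ∧ -1 ≤ g := by
  obtain ⟨N, hN⟩ := Nat.exists_mem_closure_of_ge s
  have hneg : ¬ ∃ t ∈ AddSubmonoid.closure s, (t : ℤ) = -1 := by
    rintro ⟨t, -, ht⟩
    lia
  obtain ⟨g, hg, hmax⟩ := Int.exists_greatest_of_bdd
    (P := fun z => ¬ ∃ t ∈ AddSubmonoid.closure s, (t : ℤ) = z)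
    ⟨N, fun z hz => by
      by_contra hlt
      exact hz ⟨z.toNat, hN _ (by lia) (by rw [hs]; exact one_dvd _), by lia⟩⟩ ⟨-1, hneg⟩
  exact ⟨g, ⟨hg, fun z hz => hmax z hz⟩, hmax _ hneg⟩

/-! ### Krull dimension and Hilbert polynomial of the coordinate ring -/

/-- An integral ring homomorphism has incomparable fibres on spectra, so it does not raise the
Krull dimension. -/
theorem ringKrullDim_le_of_isIntegral {R S : Type*} [CommRing R] [CommRing S] (f : R →+* S)
    (hf : f.IsIntegral) : ringKrullDim S ≤ ringKrullDim R := by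
  algebraize [f]
  refine Order.krullDim_le_of_strictMono (PrimeSpectrum.comap f) fun p q hpq => ?_
  obtain ⟨hle, x, hxq, hxp⟩ := SetLike.lt_iff_le_and_exists.1
    (show p.asIdeal < q.asIdeal from hpq)
  exact Ideal.comap_lt_comap_of_integral_mem_sdiff hle ⟨hxq, hxp⟩ (hf x)

theorem X_pow_sub_X_pow_mem_vanishingIdeal [Finite K] (i₀ i : Fin n) (v : Fin n → ℕ) :
    (X i ^ Nat.card Kˣ - X i₀ ^ Nat.card Kˣ : MvPolynomial (Fin n) K) ∈
      vanishingIdeal (torus K v) := by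
  rw [mem_vanishingIdeal_torus_iff i₀ v ((isHomogeneous_X_pow _ _).sub (isHomogeneous_X_pow _ _))]
  intro x
  have h1 : ∀ j, torusPoint v x j ^ Nat.card Kˣ = 1 := by
    intro j
    rw [torusPoint, ← Units.val_pow_eq_pow_val, ← Units.val_pow_eq_pow_val, pow_card_eq_one',
      Units.val_one]
  simp [h1]

/-- The coordinate ring is integral over the image of `K[T]`, `T ↦ t_{i₀}`, since
`t_i^{q-1} = t_{i₀}^{q-1}` in it; and it maps onto the coordinate ring `K[T]` of the line through
the point `[1 : ⋯ : 1]` of the torus. -/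
theorem ringKrullDim_quotient_vanishingIdeal_torus [Finite K] (i₀ : Fin n) (v : Fin n → ℕ) :
    ringKrullDim (MvPolynomial (Fin n) K ⧸ vanishingIdeal (torus K v)) = 1 := by
  have hdim : ringKrullDim (Polynomial K) = 1 :=
    IsPrincipalIdealRing.ringKrullDim_eq_one _ (Polynomial.not_isField K)
  apply le_antisymm
  · let ψ : Polynomial K →+* MvPolynomial (Fin n) K ⧸ vanishingIdeal (torus K v) :=
      (Ideal.Quotient.mk _).comp (Polynomial.aeval (X i₀ : MvPolynomial (Fin n) K)).toRingHom
    rw [← hdim]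
    refine ringKrullDim_le_of_isIntegral ψ fun y => ?_
    obtain ⟨f, rfl⟩ := Ideal.Quotient.mk_surjective y
    induction f using MvPolynomial.induction_on with
    | C a =>
      have : Ideal.Quotient.mk (vanishingIdeal (torus K v)) (C a) = ψ (Polynomial.C a) := by
        simp [ψ]
      rw [this]
      exact ψ.isIntegralElem_map
    | add p q hp hq =>
      rw [map_add]
      exact RingHom.IsIntegralElem.add ψ hp hq
    | mul_X p i hp =>
      rw [map_mul]
      refine RingHom.IsIntegralElem.mul ψ hp ?_
      have hpow : Ideal.Quotient.mk (vanishingIdeal (torus K v)) (X i) ^ Nat.card Kˣ =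
          ψ (Polynomial.X ^ Nat.card Kˣ) := by
        simp only [ψ, RingHom.comp_apply, AlgHom.toRingHom_eq_coe, RingHom.coe_coe, map_pow,
          Polynomial.aeval_X]
        rw [← map_pow, ← map_pow, Ideal.Quotient.eq]
        exact X_pow_sub_X_pow_mem_vanishingIdeal i₀ i v
      algebraize [ψ]
      refine IsIntegral.of_pow (R := Polynomial K) (Nat.card_pos (α := Kˣ)) ?_
      rw [hpow]
      exact isIntegral_algebraMap
  · have hker : ∀ f ∈ vanishingIdeal (torus K v),
        aeval (fun _ : Fin n => (Polynomial.X : Polynomial K)) f = 0 := by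
      have h : vanishingIdeal (torus K v) ≤ RingHom.ker
          (aeval (R := K) fun _ : Fin n => (Polynomial.X : Polynomial K)) := by
        refine Ideal.span_le.2 ?_
        intro f hf
        obtain ⟨e, he⟩ := hf.1
        have h1 : eval (torusPoint v (1 : Fin n → Kˣ)) f = 0 :=
          (mem_vanishingIdeal_torus_iff i₀ v he).1 (Ideal.subset_span hf) 1
        -- the generic point of that line is `T` times the point `(1, …, 1)`
        have h2 : (fun _ : Fin n => (Polynomial.X : Polynomial K)) =
            (Polynomial.X : Polynomial K) •
              (algebraMap K (Polynomial K) ∘ torusPoint v (1 : Fin n → Kˣ)) := by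
          funext i
          simp [torusPoint]
        rw [SetLike.mem_coe, RingHom.mem_ker, h2, aeval_smul_of_isHomogeneous he,
          aeval_algebraMap_apply, aeval_eq_eval, h1, map_zero, mul_zero]
      exact fun f hf => h hf
    rw [← hdim]
    refine ringKrullDim_le_of_surjective (Ideal.Quotient.lift _
      (aeval fun _ : Fin n => (Polynomial.X : Polynomial K)).toRingHom hker)
      (Ideal.Quotient.lift_surjective_of_surjective _ _ fun p => ?_)
    refine ⟨Polynomial.aeval (X i₀ : MvPolynomial (Fin n) K) p, ?_⟩
    change aeval (R := K) (fun _ : Fin n => (Polynomial.X : Polynomial K))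
      (Polynomial.aeval (X i₀ : MvPolynomial (Fin n) K) p) = p
    rw [← Polynomial.aeval_algHom_apply, aeval_X, Polynomial.aeval_X_left_apply]

/-- The coordinate ring has Krull dimension one, so its Hilbert polynomial is the constant eventually
taken by its Hilbert function. -/
theorem isHilbertPolynomial_C [Finite K] (i₀ : Fin n) (v : Fin n → ℕ) {δ : ℚ}
    (h : ∀ᶠ e : ℕ in Filter.atTop,
      δ = (hilbertFunction (vanishingIdeal (torus K v)) e : ℚ)) :
    IsHilbertPolynomial (vanishingIdeal (torus K v)) (Polynomial.C δ) where
  eventually_eq := by simpa using h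
  natDegree_add_one := by
    rw [ringKrullDim_quotient_vanishingIdeal_torus i₀, Polynomial.natDegree_C]
    rfl

end DegenerateTorus

/-! ### Degree and index of regularity -/

open DegenerateTorus in
theorem corollary3p12 {K : Type*} [Field K] [Finite K]
    {n : ℕ} (hn : 1 ≤ n) (v : Fin n → ℕ) (hv : ∀ i, 0 < v i)
    (β : Kˣ) (hβ : ∀ x : Kˣ, x ∈ Subgroup.zpowers β)
    (d : Fin n → ℕ) (hd : ∀ i, d i = orderOf (β ^ v i))
    (r : ℕ) (hr : r = Finset.univ.gcd d)
    (d' : Fin n → ℕ) (hd' : ∀ i, d' i = orderOf (β ^ (r * v i))) :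
    DegenerateTorus.HasDegree (DegenerateTorus.vanishingIdeal (DegenerateTorus.torus K v))
        ((∏ i, (d i : ℚ)) / (r : ℚ)) ∧
      (DegenerateTorus.IsCompleteIntersection
          (DegenerateTorus.vanishingIdeal (DegenerateTorus.torus K v)) →
        ∃ (ℓ : ℕ) (g : ℤ),
          DegenerateTorus.HasRegularityIndex
            (DegenerateTorus.vanishingIdeal (DegenerateTorus.torus K v)) ℓ ∧
          DegenerateTorus.IsFrobeniusNumber (AddSubmonoid.closure (Set.range d')) g ∧
          (ℓ : ℤ) = (r : ℤ) * g + (∑ i, (d i : ℤ)) - ((n : ℤ) - 1)) := by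
  let i₀ : Fin n := ⟨0, hn⟩
  have hdpos : ∀ i, 0 < d i := fun i => by
    rw [hd]
    exact orderOf_pos _
  have hrd : ∀ i, r ∣ d i := fun i => hr ▸ Finset.gcd_dvd (Finset.mem_univ i)
  have hrpos : 0 < r := Nat.pos_of_dvd_of_pos (hrd i₀) (hdpos i₀)
  have : ∀ i, NeZero (d i) := fun i => ⟨(hdpos i).ne'⟩
  have : NeZero r := ⟨hrpos.ne'⟩
  have hdd' : ∀ i, d i = r * d' i := by
    intro i
    rw [hd', mul_comm r (v i), pow_mul, orderOf_pow (β ^ v i), ← hd, Nat.gcd_eq_right (hrd i),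
      Nat.mul_div_cancel' (hrd i)]
  have hgcd : Nat.setGcd (Set.range d') = 1 := by
    have hdvd : r * Nat.setGcd (Set.range d') ∣ r := by
      conv_rhs => rw [hr]
      refine Finset.dvd_gcd fun i _ => ?_
      rw [hdd' i]
      exact mul_dvd_mul_left r (Nat.setGcd_dvd_of_mem ⟨i, rfl⟩)
    exact Nat.dvd_one.1 (Nat.dvd_of_mul_dvd_mul_left hrpos (by rwa [mul_one]))
  obtain ⟨g, hg, hg1⟩ := exists_isFrobeniusNumber hgcd
  have hsum : ∑ i, ((d i : ℤ) - 1) = (∑ i, (d i : ℤ)) - n := by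
    simp [Finset.sum_sub_distrib]
  have hiff : ∀ e : ℕ, (∏ i, (d i : ℚ)) / (r : ℚ) =
      (hilbertFunction (vanishingIdeal (torus K v)) e : ℚ) ↔
      (residue d '' {a | a.degree = e}).ncard * r = ∏ i, d i := by
    intro e
    rw [hilbertFunction_eq_ncard_residue i₀ hβ v d hd,
      div_eq_iff (by exact_mod_cast hrpos.ne'), eq_comm]
    exact_mod_cast Iff.rfl
  -- `r ≤ d_{i₀}` and `1 ≤ d_i` make the claimed index nonnegative, also when `g = -1`
  have hnonneg : 0 ≤ (r : ℤ) * g + (∑ i, (d i : ℤ)) - ((n : ℤ) - 1) := by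
    have h1 : (r : ℤ) * (-1) ≤ r * g := mul_le_mul_of_nonneg_left hg1 (by positivity)
    have h2 : (d i₀ : ℤ) - 1 ≤ ∑ i, ((d i : ℤ) - 1) :=
      Finset.single_le_sum (f := fun i => (d i : ℤ) - 1)
        (fun i _ => by have := hdpos i; lia) (Finset.mem_univ i₀)
    have h3 : (r : ℤ) ≤ d i₀ := by exact_mod_cast Nat.le_of_dvd (hdpos i₀) (hrd i₀)
    lia
  obtain ⟨ℓ, hℓ⟩ := Int.eq_ofNat_of_zero_le hnonneg
  have hge : ∀ e : ℕ, ℓ ≤ e → (∏ i, (d i : ℚ)) / (r : ℚ) =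
      (hilbertFunction (vanishingIdeal (torus K v)) e : ℚ) := fun e he =>
    (hiff e).2 (ncard_residue_image_eq hdd' i₀ hg (by lia))
  have hpoly := isHilbertPolynomial_C i₀ v (Filter.eventually_atTop.2 ⟨ℓ, hge⟩)
  refine ⟨⟨_, hpoly, by simp⟩, fun _ => ⟨ℓ, g, ⟨_, hpoly, ?_, ?_⟩, hg, hℓ.symm⟩⟩
  · intro e he
    rw [Polynomial.eval_C]
    exact hge e he
  · intro l hl
    by_contra hlt
    have h := hl (ℓ - 1) (by lia)
    rw [Polynomial.eval_C, hiff] at h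
    exact ncard_residue_image_ne hdd' i₀ hg (by lia) h
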